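/- Let $A=(A(i,j))_{i,j\in\mathbb N}$ be an irreducible $\{0,1\}$-matrix, i.e. for all $i,j\in\mathbb N$ there are $n\ge 1$ and $a_0=i,a_1,\dots,a_n=j$ with $A(a_k,a_{k+1})=1$ for $0\le k<n$. Let $$\Sigma_A=\{x=x_0x_1x_2\cdots\in\mathbb N^{\{0,1,2,\dots\}} : A(x_k,x_{k+1})=1\text{ for all }k\ge 0\}$$ be the Markov shift space, with the topology generated by the cylinder sets, and let $(\delta_x)_{x\in\Sigma_A}$ be the canonical orthonormal basis of $\ell^2(\Sigma_A)$. For $s\in\mathbb N$ let $T_s$ be the partial isometry on $\ell^2(\Sigma_A)$ with $T_s\delta_x=\delta_{sx}$ if $A(s,x_0)=1$ and $T_s\delta_x=0$ otherwise. Put $Q_s=T_s^*T_s$, $T_\alpha=T_{\alpha_0}\cdots T_{\alpha_n}$ for a finite word $\alpha=\alpha_0\cdots\alpha_n$, and $T_\alpha=1$ for the empty word. Let $\mathcal O_A\subseteq\mathfrak B(\ell^2(\Sigma_A))$ be the $C^*$-algebra generated by $\{T_s:s\in\mathbb N\}$, and let $$\mathcal D_A=\overline{\operatorname{span}}\Big\{T_\alpha\Big(\prod_{i\in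 F}Q_i\Big)T_\alpha^* : \alpha\text{ a finite word},\ F\subseteq\mathbb N\text{ finite}\Big\},$$ where, if $\mathcal O_A$ does not contain the identity operator, only those pairs $(\alpha,F)$ are allowed in which $\alpha$ is not the empty word or $F\neq\emptyset$. Then $\mathcal D_A$ is a commutative $C^*$-algebra; let $X_A$ be its spectrum, that is, the set of its characters with the weak$^*$ topology, and let $$i_1:\Sigma_A\to X_A,\qquad i_1(\omega)=\varphi_\omega|_{\mathcal D_A},\qquad \varphi_\omega(R)=\langle R\delta_\omega,\delta_\omega\rangle .$$ Then for every Borel set $B\subseteq\Sigma_A$, the image $i_1(B)$ is a Borel set in $X_A$. -/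

import Mathlib

open scoped ENNReal

noncomputable section

namespace MarkovCK

/-- The one-sided Markov shift space `Σ_A` over the alphabet `ℕ`. As a subtype of `ℕ → ℕ` it carries
the (relative) product topology, which is the topology generated by the cylinder sets. -/
abbrev Shift (A : Matrix ℕ ℕ ℕ) : Type :=
  {x : ℕ → ℕ // ∀ j, A (x j) (x (j + 1)) = 1}

variable {A : Matrix ℕ ℕ ℕ}

/-- A `0`-`1` matrix is irreducible if every letter can be joined to every letter by an admissible
path of positive length. -/
def IsIrreducible (A : Matrix ℕ ℕ ℕ) : Prop :=
  ∀ i j, Relation.TransGen (fun a b => A a b = 1) i j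

/-- The shift map `x₀x₁x₂⋯ ↦ x₁x₂x₃⋯`. -/
def Shift.tail (x : Shift A) : Shift A :=
  ⟨fun j => x.1 (j + 1), fun j => x.2 (j + 1)⟩

/-- The sequence `s x₀ x₁ x₂ ⋯`, for a letter `s` that may precede `x₀`. -/
def Shift.cons (s : ℕ) (x : Shift A) (h : A s (x.1 0) = 1) : Shift A :=
  ⟨fun j => Nat.casesOn j s x.1, fun j => by cases j with
    | zero => exact h
    | succ j => exact x.2 j⟩

theorem Shift.head_rel_tail (x : Shift A) : A (x.1 0) (x.tail.1 0) = 1 := x.2 0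

theorem Shift.ext_head_tail {x y : Shift A} (h0 : x.1 0 = y.1 0) (h : x.tail = y.tail) : x = y := by
  apply Subtype.ext
  funext j
  cases j with
  | zero => exact h0
  | succ j => exact congrFun (congrArg Subtype.val h) j

theorem Shift.eq_cons_iff (s : ℕ) (x : Shift A) (h : A s (x.1 0) = 1) (y : Shift A) :
    y = Shift.cons s x h ↔ y.1 0 = s ∧ y.tail = x := by
  constructor
  · rintro rfl
    exact ⟨rfl, rfl⟩
  · rintro ⟨h0, ht⟩
    exact Shift.ext_head_tail h0 ht

/-- The Hilbert space `ℓ²(Σ_A)`. -/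
abbrev L2 (A : Matrix ℕ ℕ ℕ) : Type := lp (fun _ : Shift A => ℂ) 2

/-- The vector `δ_x` of the canonical orthonormal basis of `ℓ²(Σ_A)`. -/
def δ (x : Shift A) : L2 A :=
  letI : DecidableEq (Shift A) := Classical.decEq _
  lp.single 2 x (1 : ℂ)

theorem δ_self (x : Shift A) : δ x x = 1 := by
  simp [δ]

theorem δ_ne {x y : Shift A} (h : y ≠ x) : δ x y = 0 := by
  simp [δ, h]

theorem inner_δ (x : Shift A) (f : L2 A) : inner ℂ (δ x) f = f x := by
  simp [δ, lp.inner_single_left]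

theorem summable_sq (f : L2 A) : Summable fun x => ‖f x‖ ^ 2 := by
  have := (lp.memℓp f).summable (by norm_num)
  simpa using this

theorem norm_sq_eq (f : L2 A) : ‖f‖ ^ 2 = ∑' x, ‖f x‖ ^ 2 := by
  have := lp.norm_rpow_eq_tsum (p := 2) (by norm_num) f
  simpa using this

/-- The function `y ↦ f(σ y)` on the cylinder `[s]`, extended by zero. -/
def genFun (s : ℕ) (f : Shift A → ℂ) (y : Shift A) : ℂ :=
  if y.1 0 = s then f y.tail else 0

theorem tail_injective (s : ℕ) :
    Function.Injective fun y : {y : Shift A // y.1 0 = s} => y.1.tail := by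
  intro y z h
  exact Subtype.ext (Shift.ext_head_tail (y.2.trans z.2.symm) h)

theorem genFun_sq (s : ℕ) (f : Shift A → ℂ) :
    (fun y => ‖genFun s f y‖ ^ 2) =
      Set.indicator {y : Shift A | y.1 0 = s} fun y => ‖f y.tail‖ ^ 2 := by
  funext y
  by_cases h : y.1 0 = s <;> simp [genFun, h]

theorem genFun_memℓp (s : ℕ) (f : L2 A) : Memℓp (genFun s f) 2 := by
  refine memℓp_gen ?_
  have h : Summable fun y => ‖genFun s f y‖ ^ 2 := by
    rw [genFun_sq, ← summable_subtype_iff_indicator]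
    exact (summable_sq f).comp_injective (tail_injective s)
  simpa using h

theorem genFun_norm_le (s : ℕ) (f : L2 A) : ‖(⟨genFun s f, genFun_memℓp s f⟩ : L2 A)‖ ≤ ‖f‖ := by
  refine le_of_sq_le_sq ?_ (norm_nonneg _)
  rw [norm_sq_eq, norm_sq_eq]
  change ∑' y, ‖genFun s f y‖ ^ 2 ≤ _
  rw [genFun_sq, ← tsum_subtype]
  exact tsum_comp_le_tsum_of_inj (summable_sq f) (fun _ => by positivity) (tail_injective s)

/-- The partial isometry `T_s` on `ℓ²(Σ_A)`; see `T_δ_of_rel`, `T_δ_of_not_rel`, `T_star_δ_of_mem` and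
`T_star_δ_of_not_mem` for its action, and that of its adjoint, on the canonical basis. -/
def T (s : ℕ) : L2 A →L[ℂ] L2 A :=
  LinearMap.mkContinuous
    { toFun := fun f => ⟨genFun s f, genFun_memℓp s f⟩
      map_add' := fun f g => by
        ext y
        change genFun s (f + g : L2 A) y = genFun s f y + genFun s g y
        by_cases h : y.1 0 = s <;> simp [genFun, h]
      map_smul' := fun c f => by
        ext y
        by_cases h : y.1 0 = s <;> simp [genFun, h] }
    1 (fun f => by simpa using genFun_norm_le s f)

theorem T_apply (s : ℕ) (f : L2 A) (y : Shift A) :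
    T s f y = if y.1 0 = s then f y.tail else 0 := rfl

theorem T_δ_of_rel (s : ℕ) (x : Shift A) (h : A s (x.1 0) = 1) :
    T s (δ x) = δ (Shift.cons s x h) := by
  ext y
  rw [T_apply]
  by_cases hy : y = Shift.cons s x h
  · subst hy
    rw [δ_self]
    exact (if_pos rfl).trans (δ_self x)
  · rw [δ_ne hy]
    split_ifs with h0
    · exact δ_ne fun ht => hy ((Shift.eq_cons_iff s x h y).2 ⟨h0, ht⟩)
    · rfl

theorem T_δ_of_not_rel (s : ℕ) (x : Shift A) (h : A s (x.1 0) ≠ 1) : T s (δ x) = 0 := by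
  ext y
  rw [T_apply]
  split_ifs with h0
  · refine δ_ne fun ht => h ?_
    rw [← h0, ← ht]
    exact y.head_rel_tail
  · rfl

theorem T_star_apply (s : ℕ) (f : L2 A) (x : Shift A) :
    star (T s) f x = if h : A s (x.1 0) = 1 then f (Shift.cons s x h) else 0 := by
  rw [← inner_δ, ContinuousLinearMap.star_eq_adjoint, ContinuousLinearMap.adjoint_inner_right]
  split_ifs with h
  · rw [T_δ_of_rel s x h, inner_δ]
  · rw [T_δ_of_not_rel s x h, inner_zero_left]

theorem T_star_δ_of_mem (s : ℕ) (x : Shift A) (h : x.1 0 = s) : star (T s) (δ x) = δ x.tail := by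
  ext y
  rw [T_star_apply]
  split_ifs with hy
  · by_cases hxy : y = x.tail
    · have : x = Shift.cons s y hy := (Shift.eq_cons_iff s y hy x).2 ⟨h, hxy.symm⟩
      rw [← this, hxy, δ_self, δ_self]
    · rw [δ_ne hxy, δ_ne]
      intro hc
      exact hxy ((Shift.eq_cons_iff s y hy x).1 hc.symm).2.symm
  · refine (δ_ne fun hxy => hy ?_).symm
    rw [hxy, ← h]
    exact x.head_rel_tail

theorem T_star_δ_of_not_mem (s : ℕ) (x : Shift A) (h : x.1 0 ≠ s) : star (T s) (δ x) = 0 := by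
  ext y
  rw [T_star_apply]
  split_ifs with hy
  · refine δ_ne fun hc => h ?_
    rw [← hc]
    rfl
  · rfl

/-- The projection `Q_s = T_s^* T_s`. -/
def Q (s : ℕ) : L2 A →L[ℂ] L2 A := star (T s) * T s

/-- The operator `R` is diagonal, with diagonal entries `d`. -/
def IsDiag (R : L2 A →L[ℂ] L2 A) (d : Shift A → ℂ) : Prop :=
  ∀ f x, R f x = d x * f x

theorem IsDiag.mul {R S : L2 A →L[ℂ] L2 A} {d e : Shift A → ℂ} (hR : IsDiag R d)
    (hS : IsDiag S e) : IsDiag (R * S) (d * e) := by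
  intro f x
  rw [mul_apply_eq_comp, hR, hS, Pi.mul_apply, mul_assoc]

theorem IsDiag.eq {R S : L2 A →L[ℂ] L2 A} {d : Shift A → ℂ} (hR : IsDiag R d)
    (hS : IsDiag S d) : R = S := by
  ext f x
  rw [hR, hS]

theorem isDiag_one : IsDiag (1 : L2 A →L[ℂ] L2 A) 1 := by
  intro f x
  simp

theorem isDiag_zero : IsDiag (0 : L2 A →L[ℂ] L2 A) 0 := by
  intro f x
  simp

theorem isDiag_Q (s : ℕ) :
    IsDiag (Q s : L2 A →L[ℂ] L2 A) fun x => if A s (x.1 0) = 1 then 1 else 0 := by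
  intro f x
  rw [Q, mul_apply_eq_comp, T_star_apply]
  by_cases h : A s (x.1 0) = 1
  · simp only [dif_pos h, if_pos h, one_mul]
    exact (T_apply _ _ _).trans (if_pos rfl)
  · simp only [dif_neg h, if_neg h, zero_mul]

theorem Q_commute (s t : ℕ) : Commute (Q s : L2 A →L[ℂ] L2 A) (Q t) :=
  ((isDiag_Q s).mul (isDiag_Q t)).eq (mul_comm (fun x : Shift A => if A t (x.1 0) = 1 then (1 : ℂ)
    else 0) _ ▸ (isDiag_Q t).mul (isDiag_Q s))

/-- `T_α = T_{α₀} T_{α₁} ⋯ T_{αₙ}` for a finite word `α`, with `T_α = 1` for the empty word. -/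
def Tword (α : List ℕ) : L2 A →L[ℂ] L2 A := (α.map T).prod

/-- The product `∏_{i ∈ F} Q_i` of commuting projections. -/
def Qprod (F : Finset ℕ) : L2 A →L[ℂ] L2 A :=
  F.noncommProd Q fun i _ j _ _ => Q_commute i j

/-- The operator `T_α (∏_{i ∈ F} Q_i) T_α^*`. -/
def gen (α : List ℕ) (F : Finset ℕ) : L2 A →L[ℂ] L2 A :=
  Tword α * Qprod F * star (Tword α)

/-- The C*-algebra `O_A`, realized on `ℓ²(Σ_A)`: the closed (not necessarily unital) `*`-subalgebra
generated by the operators `T_s`. -/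
def OA (A : Matrix ℕ ℕ ℕ) : NonUnitalStarSubalgebra ℂ (L2 A →L[ℂ] L2 A) :=
  (NonUnitalStarAlgebra.adjoin ℂ (Set.range (T : ℕ → L2 A →L[ℂ] L2 A))).topologicalClosure

/-- The operators `T_α (∏_{i ∈ F} Q_i) T_α^*` that span a dense subspace of `D_A`. The one for which
both `α` and `F` are empty, which is the identity, is admitted only if `O_A` is unital. -/
def genSet (A : Matrix ℕ ℕ ℕ) : Set (L2 A →L[ℂ] L2 A) :=
  {R | ∃ (α : List ℕ) (F : Finset ℕ),
    (α ≠ [] ∨ F.Nonempty ∨ (1 : L2 A →L[ℂ] L2 A) ∈ OA A) ∧ R = gen α F}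

/-- The diagonal entries of `gen α F`. -/
def genDiag (F : Finset ℕ) : List ℕ → Shift A → ℂ
  | [], x => if ∀ i ∈ F, A i (x.1 0) = 1 then 1 else 0
  | s :: α, x => if x.1 0 = s then genDiag F α x.tail else 0

theorem isDiag_Qprod (F : Finset ℕ) : IsDiag (Qprod F : L2 A →L[ℂ] L2 A) (genDiag F []) := by
  induction F using Finset.induction_on with
  | empty =>
    have h : (Qprod ∅ : L2 A →L[ℂ] L2 A) = 1 := Finset.noncommProd_empty _ _
    intro f x
    simp [h, genDiag]
  | insert a F ha ih =>
    have h : (Qprod (insert a F) : L2 A →L[ℂ] L2 A) = Q a * Qprod F :=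
      Finset.noncommProd_insert_of_notMem _ _ _ _ ha
    rw [h]
    convert (isDiag_Q a).mul ih using 1
    funext x
    by_cases h1 : A a (x.1 0) = 1 <;> simp [genDiag, h1]

theorem isDiag_conj (s : ℕ) {R : L2 A →L[ℂ] L2 A} {d : Shift A → ℂ} (h : IsDiag R d) :
    IsDiag (T s * R * star (T s)) fun x => if x.1 0 = s then d x.tail else 0 := by
  intro f x
  rw [mul_apply_eq_comp, mul_apply_eq_comp, T_apply]
  split_ifs with h0
  · have h1 : A s (x.tail.1 0) = 1 := h0 ▸ x.head_rel_tail
    rw [h, T_star_apply, dif_pos h1, ← (Shift.eq_cons_iff s x.tail h1 x).2 ⟨h0, rfl⟩]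
    simp only [if_pos h0]
  · simp only [if_neg h0, zero_mul]

theorem gen_cons (s : ℕ) (α : List ℕ) (F : Finset ℕ) :
    (gen (s :: α) F : L2 A →L[ℂ] L2 A) = T s * gen α F * star (T s) := by
  simp only [gen, Tword, List.map_cons, List.prod_cons, star_mul, mul_assoc]

theorem isDiag_gen (α : List ℕ) (F : Finset ℕ) :
    IsDiag (gen α F : L2 A →L[ℂ] L2 A) (genDiag F α) := by
  induction α with
  | nil => simpa [gen, Tword] using isDiag_Qprod F
  | cons s α ih =>
    rw [gen_cons]
    exact isDiag_conj s ih

theorem genDiag_nil_mul_cons (F G : Finset ℕ) (t : ℕ) (β : List ℕ) :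
    (genDiag F [] * genDiag G (t :: β) : Shift A → ℂ) = 0 ∨
      (genDiag F [] * genDiag G (t :: β) : Shift A → ℂ) = genDiag G (t :: β) := by
  by_cases h : ∀ i ∈ F, A i t = 1
  · right
    funext x
    by_cases h0 : x.1 0 = t
    · simp only [Pi.mul_apply, genDiag, h0, if_pos h, one_mul]
    · simp only [Pi.mul_apply, genDiag, if_neg h0, mul_zero]
  · left
    funext x
    by_cases h0 : x.1 0 = t
    · simp only [Pi.mul_apply, genDiag, h0, if_neg h, zero_mul, Pi.zero_apply]
    · simp only [Pi.mul_apply, genDiag, if_neg h0, mul_zero, Pi.zero_apply]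

theorem genDiag_mul (F G : Finset ℕ) (α β : List ℕ) :
    (genDiag F α * genDiag G β : Shift A → ℂ) = 0 ∨
      ∃ (γ : List ℕ) (H : Finset ℕ), (genDiag F α * genDiag G β : Shift A → ℂ) = genDiag H γ ∧
        (γ = [] → α = [] ∧ F ⊆ H) := by
  induction α generalizing β with
  | nil =>
    cases β with
    | nil =>
      refine Or.inr ⟨[], F ∪ G, ?_, fun _ => ⟨rfl, Finset.subset_union_left⟩⟩
      funext x
      simp only [Pi.mul_apply, genDiag, Finset.mem_union, or_imp, forall_and]
      by_cases h1 : ∀ i ∈ F, A i (x.1 0) = 1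
      · by_cases h2 : ∀ i ∈ G, A i (x.1 0) = 1
        · rw [if_pos h1, if_pos h2, if_pos ⟨h1, h2⟩, one_mul]
        · rw [if_neg h2, mul_zero, if_neg fun h => h2 h.2]
      · rw [if_neg h1, zero_mul, if_neg fun h => h1 h.1]
    | cons t β =>
      rcases genDiag_nil_mul_cons (A := A) F G t β with h | h
      · exact Or.inl h
      · exact Or.inr ⟨t :: β, G, h, fun h => by simp at h⟩
  | cons s α ih =>
    cases β with
    | nil =>
      rw [mul_comm]
      rcases genDiag_nil_mul_cons (A := A) G F s α with h | h
      · exact Or.inl h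
      · exact Or.inr ⟨s :: α, F, h, fun h => by simp at h⟩
    | cons t β =>
      by_cases hst : s = t
      · subst hst
        have key : (genDiag F (s :: α) * genDiag G (s :: β) : Shift A → ℂ) =
            fun x => if x.1 0 = s then (genDiag F α * genDiag G β : Shift A → ℂ) x.tail else 0 := by
          funext x
          by_cases h0 : x.1 0 = s <;> simp [genDiag, h0]
        rcases ih β with h | ⟨γ, H, h, -⟩
        · left
          rw [key, h]
          funext x
          simp
        · right
          refine ⟨s :: γ, H, ?_, fun h => by simp at h⟩
          rw [key, h]
          rfl
      · left
        funext x
        by_cases h0 : x.1 0 = s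
        · have : x.1 0 ≠ t := fun h => hst (h0.symm.trans h)
          simp [genDiag, this]
        · simp [genDiag, h0]

theorem genSet_mul {R S : L2 A →L[ℂ] L2 A} (hR : R ∈ genSet A) (hS : S ∈ genSet A) :
    R * S = 0 ∨ R * S ∈ genSet A := by
  obtain ⟨α, F, hF, rfl⟩ := hR
  obtain ⟨β, G, -, rfl⟩ := hS
  have hd := (isDiag_gen (A := A) α F).mul (isDiag_gen β G)
  rcases genDiag_mul (A := A) F G α β with h | ⟨γ, H, h, hγ⟩
  · rw [h] at hd
    exact Or.inl (hd.eq isDiag_zero)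
  · rw [h] at hd
    refine Or.inr ⟨γ, H, ?_, hd.eq (isDiag_gen γ H)⟩
    by_cases hn : γ = []
    · obtain ⟨h1, h2⟩ := hγ hn
      rcases hF with hF | hF | hF
      · exact absurd h1 hF
      · exact Or.inr (Or.inl (hF.mono h2))
      · exact Or.inr (Or.inr hF)
    · exact Or.inl hn

theorem star_eq_of_isDiag_real {R : L2 A →L[ℂ] L2 A} {d : Shift A → ℂ} (h : IsDiag R d)
    (hd : ∀ x, star (d x) = d x) : star R = R := by
  refine IsDiag.eq (d := d) ?_ h
  intro f x
  have h1 : R (δ x) = d x • δ x := by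
    ext y
    rw [h]
    by_cases hy : y = x
    · subst hy
      rfl
    · simp [δ_ne hy]
  rw [← inner_δ, ContinuousLinearMap.star_eq_adjoint, ContinuousLinearMap.adjoint_inner_right, h1,
    inner_smul_left, inner_δ]
  congr 1
  exact hd x

theorem genDiag_real (F : Finset ℕ) (α : List ℕ) (x : Shift A) :
    star (genDiag F α x) = genDiag F α x := by
  induction α generalizing x with
  | nil => simp only [genDiag]; split_ifs <;> simp
  | cons s α ih =>
    simp only [genDiag]
    split_ifs
    · exact ih _
    · simp

theorem span_mul {R S : L2 A →L[ℂ] L2 A} (hR : R ∈ Submodule.span ℂ (genSet A))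
    (hS : S ∈ Submodule.span ℂ (genSet A)) : R * S ∈ Submodule.span ℂ (genSet A) := by
  have h := Submodule.mul_mem_mul hR hS
  rw [Submodule.span_mul_span] at h
  refine Submodule.span_le.2 ?_ h
  rintro _ ⟨R, hR, S, hS, rfl⟩
  rcases genSet_mul hR hS with h | h
  · simp [h]
  · exact Submodule.subset_span h

theorem span_star {R : L2 A →L[ℂ] L2 A} (hR : R ∈ Submodule.span ℂ (genSet A)) :
    star R ∈ Submodule.span ℂ (genSet A) := by
  induction hR using Submodule.span_induction with
  | mem R h =>
    obtain ⟨α, F, -, rfl⟩ := id h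
    rw [star_eq_of_isDiag_real (isDiag_gen α F) (genDiag_real F α)]
    exact Submodule.subset_span h
  | zero => simp
  | add R S _ _ hR hS => rw [star_add]; exact add_mem hR hS
  | smul c R _ hR => rw [star_smul]; exact Submodule.smul_mem _ _ hR

/-- The commutative C*-algebra `D_A`: the norm closure of the linear span of the operators
`T_α (∏_{i ∈ F} Q_i) T_α^*`. -/
def DA (A : Matrix ℕ ℕ ℕ) : NonUnitalStarSubalgebra ℂ (L2 A →L[ℂ] L2 A) where
  carrier := closure (Submodule.span ℂ (genSet A) : Set (L2 A →L[ℂ] L2 A))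
  add_mem' hR hS := (Submodule.span ℂ (genSet A)).topologicalClosure.add_mem hR hS
  zero_mem' := (Submodule.span ℂ (genSet A)).topologicalClosure.zero_mem
  mul_mem' hR hS := map_mem_closure₂ continuous_mul hR hS fun _ h1 _ h2 => span_mul h1 h2
  smul_mem' c _ hR := (Submodule.span ℂ (genSet A)).topologicalClosure.smul_mem c hR
  star_mem' hR := map_mem_closure continuous_star hR fun _ h => span_star h

/-- The space `X_A`: the spectrum of `D_A`, i.e. the set of its characters (nonzero multiplicative
continuous linear functionals) with the weak-* topology. -/
abbrev X (A : Matrix ℕ ℕ ℕ) : Type := WeakDual.characterSpace ℂ (DA A)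

theorem DA_diag {R : L2 A →L[ℂ] L2 A} (hR : R ∈ DA A) (x : Shift A) :
    R (δ x) = (inner ℂ (δ x) (R (δ x))) • δ x := by
  have hcl : IsClosed {R : L2 A →L[ℂ] L2 A | R (δ x) = (inner ℂ (δ x) (R (δ x))) • δ x} := by
    apply isClosed_eq <;> fun_prop
  refine closure_minimal (fun R hR => ?_) hcl hR
  change R ∈ Submodule.span ℂ (genSet A) at hR
  change R (δ x) = (inner ℂ (δ x) (R (δ x))) • δ x
  induction hR using Submodule.span_induction with
  | mem R h =>
    obtain ⟨α, F, -, rfl⟩ := h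
    ext y
    rw [inner_δ, isDiag_gen]
    change _ = gen α F (δ x) x * δ x y
    by_cases hy : y = x
    · subst hy
      rw [isDiag_gen, δ_self, mul_one, mul_one]
    · rw [δ_ne hy, mul_zero, mul_zero]
  | zero => simp
  | add R S _ _ hR hS =>
    rw [add_apply, inner_add_right, add_smul, ← hR, ← hS]
  | smul c R _ hR =>
    rw [smul_apply, inner_smul_right, mul_smul, ← hR]

/-- The evaluation map `φ_ω(R) = ⟨R δ_ω, δ_ω⟩` on `𝔅(ℓ²(Σ_A))`; the inner product of Mathlib is linear
in its second argument. -/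
def φ (ω : Shift A) : (L2 A →L[ℂ] L2 A) →L[ℂ] ℂ :=
  (innerSL ℂ (δ ω)).comp (ContinuousLinearMap.apply ℂ (L2 A) (δ ω))

theorem φ_apply (ω : Shift A) (R : L2 A →L[ℂ] L2 A) : φ ω R = inner ℂ (δ ω) (R (δ ω)) := rfl

/-- The restriction of `φ_ω` to `D_A`. -/
def φDA (ω : Shift A) : WeakDual ℂ (DA A) :=
  StrongDual.toWeakDual ((φ ω).comp (DA A).toSubmodule.subtypeL)

theorem φDA_apply (ω : Shift A) (R : DA A) : φDA ω R = φ ω (R : L2 A →L[ℂ] L2 A) := rfl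

theorem φDA_mem (ω : Shift A) : φDA ω ∈ WeakDual.characterSpace ℂ (DA A) := by
  constructor
  · intro h
    have hmem : gen [ω.1 0] ∅ ∈ DA A :=
      subset_closure (Submodule.subset_span ⟨[ω.1 0], ∅, Or.inl (by simp), rfl⟩)
    have h1 : φDA ω ⟨gen [ω.1 0] ∅, hmem⟩ = 0 := by rw [h]; rfl
    rw [φDA_apply, φ_apply, inner_δ, isDiag_gen, δ_self] at h1
    simp [genDiag] at h1
  · intro R S
    rw [φDA_apply, φDA_apply, φDA_apply, φ_apply]
    change inner ℂ (δ ω) ((R : L2 A →L[ℂ] L2 A) ((S : L2 A →L[ℂ] L2 A) (δ ω))) = _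
    rw [DA_diag S.2 ω, map_smul, inner_smul_right, mul_comm]
    rfl

/-- The inclusion `i₁ : Σ_A → X_A`, `ω ↦ φ_ω|_{D_A}`. -/
def i₁ (ω : Shift A) : X A := ⟨φDA ω, φDA_mem ω⟩

end MarkovCK

end

namespace MarkovCK

variable {A : Matrix ℕ ℕ ℕ}

/-! The map `i₁` is injective, so the sets `B` with Borel image form a σ-algebra as soon as the
range of `i₁` is Borel; it then suffices to treat open `B`. Both tasks rest on the projections
`cylProj x n` onto cylinders. Each condition `f (cylProj x n) = 1` is closed in `X A`, and only
countably many cylinders exist. By `mem_range_i₁`, a character lies in the range exactly when for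
every `n` it is `1` on some cylinder of length `n + 1`, so the range is a countable intersection of
countable unions of closed sets (`range_i₁`). The image of an open set is the range cut by the
countable union of the conditions for the cylinders inside that set (`image_i₁_of_isOpen`). Behind
`mem_range_i₁`: the selected cylinders are nested and define a point `ω`; every generator is
constant on long enough cylinders, so its value under the character is its diagonal entry at `ω`. -/

/-! ### Cylinder projections and their diagonal entries -/

theorem genDiag_empty (α : List ℕ) (x : Shift A) :
    genDiag ∅ α x = if ∀ (i : ℕ) (h : i < α.length), x.1 i = α[i] then 1 else 0 := by
  induction α generalizing x with
  | nil => simp [genDiag]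
  | cons s α ih =>
    have h : (∀ (i : ℕ) (h : i < (s :: α).length), x.1 i = (s :: α)[i]) ↔
        x.1 0 = s ∧ ∀ (i : ℕ) (h : i < α.length), x.tail.1 i = α[i] := by
      constructor
      · intro h
        exact ⟨h 0 (by simp), fun i hi => h (i + 1) (by simpa using hi)⟩
      · rintro ⟨h0, h1⟩ i hi
        cases i with
        | zero => exact h0
        | succ i => exact h1 i (by simpa using hi)
    simp only [genDiag, ih]
    by_cases h0 : x.1 0 = s
    · simp only [h0, if_true, h, true_and]
    · simp only [h0, if_false, h, false_and]

/-- `genDiag F β` depends only on the first `β.length + 1` letters. -/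
theorem genDiag_congr (F : Finset ℕ) (β : List ℕ) {x y : Shift A}
    (h : ∀ i ≤ β.length, x.1 i = y.1 i) : genDiag F β x = genDiag F β y := by
  induction β generalizing x y with
  | nil => simp only [genDiag, h 0 le_rfl]
  | cons s β ih =>
    have := ih (x := x.tail) (y := y.tail) fun i hi => h (i + 1) (by simpa using hi)
    simp only [genDiag, h 0 (Nat.zero_le _), this]

/-- The first `n + 1` letters of `x`. -/
def initialWord (x : Shift A) (n : ℕ) : List ℕ := List.ofFn fun i : Fin (n + 1) => x.1 i

theorem genDiag_initialWord (x y : Shift A) (n : ℕ) :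
    genDiag ∅ (initialWord x n) y = if ∀ i ≤ n, y.1 i = x.1 i then 1 else 0 := by
  simp only [genDiag_empty, initialWord, List.length_ofFn, List.getElem_ofFn, Nat.lt_succ_iff]

/-- The projection in `D_A` onto the cylinder of all sequences that start with `x₀x₁⋯xₙ`. -/
noncomputable def cylProj (x : Shift A) (n : ℕ) : DA A :=
  ⟨gen (initialWord x n) ∅, subset_closure (Submodule.subset_span
    ⟨initialWord x n, ∅, Or.inl (by simp [initialWord]), rfl⟩)⟩

theorem isDiag_cylProj (x : Shift A) (n : ℕ) :
    IsDiag (cylProj x n : L2 A →L[ℂ] L2 A)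
      fun y => if ∀ i ≤ n, y.1 i = x.1 i then 1 else 0 := by
  have := isDiag_gen (A := A) (initialWord x n) ∅
  rwa [show (genDiag ∅ (initialWord x n) : Shift A → ℂ) = _ from
    funext fun y => genDiag_initialWord x y n] at this

theorem i₁_apply_of_isDiag (ω : Shift A) (R : DA A) {d : Shift A → ℂ}
    (h : IsDiag (R : L2 A →L[ℂ] L2 A) d) : i₁ ω R = d ω := by
  change φDA ω R = d ω
  rw [φDA_apply, φ_apply, inner_δ, h, δ_self, mul_one]

theorem i₁_cylProj (ω x : Shift A) (n : ℕ) :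
    i₁ ω (cylProj x n) = if ∀ i ≤ n, ω.1 i = x.1 i then 1 else 0 :=
  i₁_apply_of_isDiag ω _ (isDiag_cylProj x n)

/-- Points that differ at the letter `n` are separated by the projection onto the cylinder of the
first `n + 1` letters of one of them. -/
theorem i₁_injective : Function.Injective (i₁ : Shift A → X A) := by
  intro ω x h
  apply Subtype.ext
  funext n
  have h1 := i₁_cylProj ω x n
  rw [h, i₁_cylProj x x n] at h1
  by_contra hn
  have h2 : ¬ ∀ i ≤ n, ω.1 i = x.1 i := fun h => hn (h n le_rfl)
  simp [h2] at h1

/-! ### Which characters are point evaluations -/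

/-- Characters of `D_A` are determined by their values on the operators `gen α F`. -/
theorem character_ext {f g : X A}
    (h : ∀ (α : List ℕ) (F : Finset ℕ) (hm : gen α F ∈ DA A), f ⟨gen α F, hm⟩ = g ⟨gen α F, hm⟩) :
    f = g := by
  have hspan : ∀ R ∈ Submodule.span ℂ (genSet A), ∀ hR : R ∈ DA A, f ⟨R, hR⟩ = g ⟨R, hR⟩ := by
    intro R hR
    induction hR using Submodule.span_induction with
    | mem R hR =>
      obtain ⟨α, F, -, rfl⟩ := hR
      exact h α F
    | zero =>
      intro h0
      exact (map_zero f).trans (map_zero g).symm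
    | add R S hR hS ihR ihS =>
      intro h0
      have hR' : R ∈ DA A := subset_closure hR
      have hS' : S ∈ DA A := subset_closure hS
      have := congrArg₂ (· + ·) (ihR hR') (ihS hS')
      simp only [← map_add] at this
      exact this
    | smul c R hR ih =>
      intro h0
      have hR' : R ∈ DA A := subset_closure hR
      exact (map_smul f c (⟨R, hR'⟩ : DA A)).trans
        ((congrArg (c • ·) (ih hR')).trans (map_smul g c (⟨R, hR'⟩ : DA A)).symm)
  refine DFunLike.ext f g fun R => ?_
  obtain ⟨r, hr, hlim⟩ := mem_closure_iff_seq_limit.1 R.2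
  have hlim' : Filter.Tendsto (fun n => (⟨r n, subset_closure (hr n)⟩ : DA A)) Filter.atTop
      (nhds R) := tendsto_subtype_rng.2 hlim
  have hf := ((map_continuous f).tendsto R).comp hlim'
  have hg := ((map_continuous g).tendsto R).comp hlim'
  refine tendsto_nhds_unique hf (hg.congr fun n => ?_)
  exact (hspan _ (hr n) _).symm

theorem character_eq_zero_of_isDiag_zero (f : X A) (R : DA A)
    (h : IsDiag (R : L2 A →L[ℂ] L2 A) 0) : f R = 0 := by
  have : R = 0 := Subtype.ext (h.eq isDiag_zero)
  rw [this, map_zero]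

/-- A character that is `1` on a cylinder projection of every length is a point evaluation. -/
theorem mem_range_i₁ (f : X A) (h : ∀ n, ∃ x, f (cylProj x n) = 1) : f ∈ Set.range i₁ := by
  choose x hx using h
  have hcomp : ∀ m n, m ≤ n → ∀ i ≤ m, (x m).1 i = (x n).1 i := by
    intro m n hmn
    by_contra hne
    -- Incompatible prefixes give disjoint cylinders, whose projections have product zero, while
    -- multiplicativity of `f` gives the value `1`.
    have h1 : f (cylProj (x m) m * cylProj (x n) n) = 1 := by
      rw [map_mul, hx, hx, mul_one]
    rw [character_eq_zero_of_isDiag_zero] at h1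
    · exact zero_ne_one h1
    have hd := (isDiag_cylProj (x m) m).mul (isDiag_cylProj (x n) n)
    refine (congrArg (IsDiag _) ?_).mp hd
    funext y
    simp only [Pi.zero_apply, Pi.mul_apply]
    by_cases hm : ∀ i ≤ m, y.1 i = (x m).1 i
    · have hn : ¬ ∀ i ≤ n, y.1 i = (x n).1 i := fun hn =>
        hne fun i hi => (hm i hi).symm.trans (hn i (hi.trans hmn))
      rw [if_neg hn, mul_zero]
    · rw [if_neg hm, zero_mul]
  -- Diagonal choice of letters. Admissibility of the step from `j` to `j + 1` is read off inside
  -- the single sequence `x (j + 1)`.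
  let ω : Shift A := ⟨fun i => (x i).1 i, fun j => by
    change A ((x j).1 j) ((x (j + 1)).1 (j + 1)) = 1
    rw [hcomp j (j + 1) (Nat.le_succ j) j le_rfl]
    exact (x (j + 1)).2 j⟩
  have hω : ∀ n, ∀ i ≤ n, (x n).1 i = ω.1 i := fun n i hi => (hcomp i n hi i le_rfl).symm
  refine ⟨ω, character_ext fun β F hm => ?_⟩
  rw [i₁_apply_of_isDiag ω _ (isDiag_gen β F)]
  -- The cylinder fixes `β.length + 1` letters: those compared with `β`, and the next one, on which
  -- `F` is tested. The generator thus acts on it as a scalar.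
  have hmul : (⟨gen β F, hm⟩ : DA A) * cylProj (x β.length) β.length =
      genDiag F β ω • cylProj (x β.length) β.length := by
    apply Subtype.ext
    refine IsDiag.eq ((isDiag_gen β F).mul (isDiag_cylProj _ _)) ?_
    intro v y
    change genDiag F β ω * (cylProj (x β.length) β.length : L2 A →L[ℂ] L2 A) v y = _
    rw [isDiag_cylProj, Pi.mul_apply, mul_assoc]
    by_cases hy : ∀ i ≤ β.length, y.1 i = (x β.length).1 i
    · rw [genDiag_congr F β fun i hi => (hy i hi).trans (hω _ i hi)]
    · simp only [if_neg hy, zero_mul, mul_zero]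
  have := congrArg f hmul
  rw [map_mul, map_smul, hx, mul_one, smul_eq_mul, mul_one] at this
  exact this.symm

/-! ### Borel descriptions of the range and of images of open sets -/

theorem isClosed_cylProj_eq_one (x : Shift A) (n : ℕ) :
    IsClosed {f : X A | f (cylProj x n) = 1} :=
  isClosed_eq ((WeakDual.eval_continuous (cylProj x n)).comp continuous_subtype_val)
    continuous_const

/-- The index `x` may run over an uncountable set, but the projection depends only on a finite word.
Hence the unions below are indexed by projections rather than points. -/
theorem countable_range_cylProj (n : ℕ) :
    (Set.range fun x : Shift A => cylProj x n).Countable := by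
  have h : (Set.range fun x : Shift A => (cylProj x n : L2 A →L[ℂ] L2 A)) ⊆
      Set.range fun α : List ℕ => (gen α ∅ : L2 A →L[ℂ] L2 A) := by
    rintro _ ⟨x, rfl⟩
    exact ⟨initialWord x n, rfl⟩
  refine Set.countable_of_injective_of_countable_image (f := Subtype.val)
    Subtype.val_injective.injOn ((Set.countable_range _).mono (Set.Subset.trans ?_ h))
  rintro _ ⟨_, ⟨x, rfl⟩, rfl⟩
  exact ⟨x, rfl⟩

theorem range_i₁ : Set.range (i₁ : Shift A → X A) =
    ⋂ n, ⋃ R ∈ Set.range fun x : Shift A => cylProj x n, {f : X A | f R = 1} := by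
  ext f
  simp only [Set.mem_iInter, Set.mem_iUnion, Set.mem_range, Set.mem_ofPred_eq, exists_prop,
    exists_exists_eq_and]
  constructor
  · rintro ⟨ω, rfl⟩ n
    exact ⟨ω, by simp [i₁_cylProj]⟩
  · exact mem_range_i₁ f

theorem image_i₁_of_isOpen {U : Set (Shift A)} (hU : IsOpen U) :
    i₁ '' U = Set.range i₁ ∩ ⋃ n, ⋃ R ∈ (fun x => cylProj x n) ''
      {x : Shift A | ∀ y : Shift A, (∀ i ≤ n, y.1 i = x.1 i) → y ∈ U}, {f : X A | f R = 1} := by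
  ext f
  simp only [Set.mem_inter_iff, Set.mem_iUnion, Set.mem_image, Set.mem_ofPred_eq, exists_prop,
    exists_exists_and_eq_and]
  constructor
  · rintro ⟨ω, hω, rfl⟩
    refine ⟨⟨ω, rfl⟩, ?_⟩
    obtain ⟨V, hV, rfl⟩ := isOpen_induced_iff.1 hU
    obtain ⟨I, u, hu, hsub⟩ := isOpen_pi_iff.1 hV ω.1 hω
    -- A basic neighbourhood restricts only the coordinates in `I`, so a prefix reaching the largest
    -- of them suffices; for empty `I` the supremum is `0`, which is harmless.
    refine ⟨I.sup id, ω, fun y hy => hsub fun i hi => ?_, by simp [i₁_cylProj]⟩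
    rw [hy i (Finset.le_sup (f := id) hi)]
    exact (hu i hi).2
  · rintro ⟨⟨ω, rfl⟩, n, x, hx, h⟩
    refine ⟨ω, hx ω ?_, rfl⟩
    rw [i₁_cylProj] at h
    by_contra hne
    simp [hne] at h

end MarkovCK

theorem mainTheorem9 (A : Matrix ℕ ℕ ℕ) (hA01 : ∀ i j, A i j = 0 ∨ A i j = 1)
    (hA : MarkovCK.IsIrreducible A) (B : Set (MarkovCK.Shift A))
    (hB : @MeasurableSet (MarkovCK.Shift A) (borel (MarkovCK.Shift A)) B) :
    @MeasurableSet (MarkovCK.X A) (borel (MarkovCK.X A)) (MarkovCK.i₁ '' B) := by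
  let _ : MeasurableSpace (MarkovCK.X A) := borel _
  have : BorelSpace (MarkovCK.X A) := ⟨rfl⟩
  have hone : ∀ n, ∀ R ∈ Set.range fun x : MarkovCK.Shift A => MarkovCK.cylProj x n,
      MeasurableSet {f : MarkovCK.X A | f R = 1} := by
    rintro n _ ⟨x, rfl⟩
    exact (MarkovCK.isClosed_cylProj_eq_one x n).measurableSet
  have hrange : MeasurableSet (Set.range (MarkovCK.i₁ : MarkovCK.Shift A → MarkovCK.X A)) := by
    rw [MarkovCK.range_i₁]
    exact .iInter fun n => .biUnion (MarkovCK.countable_range_cylProj n) (hone n)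
  change MeasurableSet (MarkovCK.i₁ '' B)
  induction B, hB using MeasurableSpace.generateFrom_induction with
  | hC U hU _ =>
    rw [MarkovCK.image_i₁_of_isOpen hU]
    refine hrange.inter (.iUnion fun n => .biUnion
      ((MarkovCK.countable_range_cylProj n).mono (Set.image_subset_range _ _)) fun R hR => ?_)
    exact hone n R (Set.image_subset_range _ _ hR)
  | empty => rw [Set.image_empty]; exact .empty
  | compl B _ ih =>
    -- Complements are where injectivity and the Borel range are both needed.
    rw [Set.image_compl_eq_range_sdiff_image MarkovCK.i₁_injective]
    exact hrange.diff ih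
  | iUnion s _ ih =>
    rw [Set.image_iUnion]
    exact .iUnion ih
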